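/- Let $\alpha\in\mathbb R$ be irrational and $0<t<\tfrac12$. For $s>0$ put $X_\alpha(s)=\{n\in\mathbb Z : n\alpha \bmod 1\in(-s,s)\}$, where $n\alpha \bmod 1\in\mathbb R/\mathbb Z$ and $(-s,s)$ stands for its image in $\mathbb R/\mathbb Z$. Let $\mathcal G=(\mathbb Z,+,X_\alpha(t))$ and let $\mathcal G^*$ (with underlying group $\mathbb Z^*$) be an elementary extension of $\mathcal G$ which is $\kappa$-saturated and strongly $\kappa$-homogeneous for some cardinal $\kappa>2^{\aleph_0}$. Call a set of parameters small if its cardinality is less than $\kappa$, and call a subgroup of $\mathcal G^*$ of bounded index if its index is less than $\kappa$; a subset is type-definable over $A$ if it is an intersection of sets definable over $A$. For $A\subseteq\mathcal G^*$ small, let $\mathcal G^{*0}_A$ be the intersection of all $A$-definable subgroups of $\mathcal G^*$ of finite index, and let $\mathcal G^{*00}_A$ be the smallest subgroup of bounded index that is type-definable over $A$. Then: 1. For every integer $n\ge 1$ the set $X_\alpha(t/n)$ is $\emptyset$-definable in $\mathcal G$; we write $X_\alpha(t/n)$ also for its interpretation in $\mathcal G^*$ (the set defined in $\mathcal G^*$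 by the same formula). 2. $\mathcal G^{*0}_A=\mathcal G^{*0}_\emptyset$ for every small $A$, and this common group $\mathcal G^{*0}$ equals $\bigcap_{n\ge1} n\mathbb Z^*$. 3. The set $\tilde{\mathcal G}=\mathcal G^{*0}\cap\bigcap_{n\ge1}X_\alpha(t/n)$ is a subgroup of $\mathcal G^*$ that is type-definable over $\emptyset$, of bounded index, and strictly smaller than $\mathcal G^{*0}$. 4. $\mathcal G^{*00}_\emptyset$ exists and $\mathcal G^{*00}_\emptyset\subseteq\tilde{\mathcal G}$. -/

import Mathlib

open FirstOrder FirstOrder.Language Cardinal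

universe u

namespace IntExpansion

/-! ### General model theory: saturation and connected components -/

section ModelTheory

/-- `κ`-saturation: every set of formulas in one variable with fewer than `κ` parameters from `M`
which is finitely satisfiable in `M` is realized in `M`. -/
def IsSaturated (L : FirstOrder.Language.{0, 0}) (M : Type u) [L.Structure M] (κ : Cardinal.{u}) : Prop :=
  ∀ A : Set M, #A < κ → ∀ p : Set (L[[A]].Formula (Fin 1)),
    (∀ q : Set (L[[A]].Formula (Fin 1)), q ⊆ p → q.Finite →
      ∃ x : M, ∀ φ ∈ q, φ.Realize (fun _ => x)) →
    ∃ x : M, ∀ φ ∈ p, φ.Realize (fun _ => x)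

/-- Strong `κ`-homogeneity: every elementary map with a domain of cardinality less than `κ`
extends to an automorphism of `M`. -/
def IsStronglyHomogeneous (L : FirstOrder.Language.{0, 0}) (M : Type u) [L.Structure M]
    (κ : Cardinal.{u}) : Prop :=
  ∀ A : Set M, #A < κ → ∀ f : A → M,
    (∀ φ : L.Formula A, φ.Realize (fun a : A => (a : M)) ↔ φ.Realize f) →
    ∃ σ : M ≃[L] M, ∀ a : A, σ a = f a

/-- A set is type-definable over `A` if it is an intersection of sets definable over `A`. -/
def IsTypeDefinable (L : FirstOrder.Language.{0, 0}) {M : Type u} [L.Structure M] (A : Set M)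
    (X : Set M) : Prop :=
  ∃ S : Set (Set M), (∀ Y ∈ S, A.Definable₁ L Y) ∧ X = ⋂₀ S

/-- The interpretation in `N` of a `∅`-definable subset `S` of `M` (of use when `N` is an elementary
extension of `M`): the points of `N` that satisfy a formula defining `S` in `M`. By elementarity
all formulas defining `S` in `M` define the same subset of `N`. -/
def interpretation (L : FirstOrder.Language.{0, 0}) {M : Type} [L.Structure M] (N : Type u) [L.Structure N]
    (S : Set M) : Set N :=
  {x | ∃ φ : L.Formula (Fin 1), S = {a : M | φ.Realize (fun _ => a)} ∧ φ.Realize (fun _ => x)}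

/-- `G_A^0`: the intersection of all `A`-definable subgroups of finite index. -/
def connectedComponent (L : FirstOrder.Language.{0, 0}) {M : Type u} [L.Structure M] [AddCommGroup M]
    (A : Set M) : AddSubgroup M :=
  sInf {H | A.Definable₁ L (H : Set M) ∧ H.FiniteIndex}

/-- A subgroup has bounded index if its index is smaller than `κ`. -/
def HasBoundedIndex {M : Type u} [AddCommGroup M] (κ : Cardinal.{u}) (H : AddSubgroup M) : Prop :=
  #(M ⧸ H) < κ

/-- `H` is `G_A^00`: the smallest subgroup of bounded index that is type-definable over `A`. -/
def IsTypeConnectedComponent (L : FirstOrder.Language.{0, 0}) {M : Type u} [L.Structure M] [AddCommGroup M]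
    (κ : Cardinal.{u}) (A : Set M) (H : AddSubgroup M) : Prop :=
  IsLeast {H : AddSubgroup M | IsTypeDefinable L A (H : Set M) ∧ HasBoundedIndex κ H} H

end ModelTheory

/-! ### The structure `(ℤ, +, X_α(t))` -/

/-- The only function symbol: binary addition. -/
inductive Func : ℕ → Type
  | add : Func 2

/-- The only relation symbol: a unary predicate. -/
inductive Rel : ℕ → Type
  | pred : Rel 1

/-- The language `{+, P}`. -/
def Lang : FirstOrder.Language.{0, 0} := ⟨Func, Rel⟩

/-- The homomorphism `ℤ → ℝ/ℤ`, `n ↦ nα mod 1`. -/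
noncomputable def rot (α : ℝ) (n : ℤ) : UnitAddCircle := ((n * α : ℝ) : UnitAddCircle)

/-- `X_α(t) = {n : nα mod 1 ∈ (-t, t)}`. -/
def X (α t : ℝ) : Set ℤ :=
  rot α ⁻¹' ((fun x : ℝ => (x : UnitAddCircle)) '' Set.Ioo (-t) t)

/-- The carrier `ℤ` of the structure `(ℤ, +, X_α(t))`. -/
@[nolint unusedArguments]
def ZX (_α _t : ℝ) : Type := ℤ

instance (α t : ℝ) : AddCommGroup (ZX α t) := inferInstanceAs (AddCommGroup ℤ)

/-- The structure `(ℤ, +, X_α(t))`. -/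
instance instStructureZX (α t : ℝ) : Lang.Structure (ZX α t) where
  funMap
    | Func.add, v => v 0 + v 1
  RelMap
    | Rel.pred, v => v 0 ∈ X α t

/-- An elementary extension of `(ℤ, +, X_α(t))`. -/
structure ElemExt (α t : ℝ) where
  /-- the underlying set -/
  carrier : Type u
  /-- the structure -/
  str : Lang.Structure carrier
  /-- the elementary embedding -/
  emb : ZX α t ↪ₑ[Lang] carrier

namespace ElemExt

variable {α t : ℝ}

instance : CoeSort (ElemExt.{u} α t) (Type u) := ⟨ElemExt.carrier⟩

instance instStructure (G : ElemExt.{u} α t) : Lang.Structure G := G.str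

/-- The group operation of an elementary extension is the interpretation of the symbol `+`. -/
def op (G : ElemExt.{u} α t) (x y : G) : G :=
  Structure.funMap (L := Lang) (M := G) Func.add ![x, y]

/-- The sum of two terms. -/
def addTerm {β : Type} (a b : Lang.Term β) : Lang.Term β :=
  Functions.apply₂ (L := Lang) Func.add a b

theorem realize_addTerm (G : ElemExt.{u} α t) {β : Type} (v : β → G) (a b : Lang.Term β) :
    (addTerm a b).realize v = G.op (a.realize v) (b.realize v) := by
  unfold addTerm op
  exact Term.realize_functions_apply₂

theorem realize_addTerm_int {β : Type} (v : β → ZX α t) (a b : Lang.Term β) :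
    (addTerm a b).realize v = a.realize v + b.realize v := by
  unfold addTerm
  exact Term.realize_functions_apply₂

theorem op_assoc (G : ElemExt.{u} α t) (x y z : G) : G.op (G.op x y) z = G.op x (G.op y z) := by
  let φ : Lang.Sentence := ∀' ∀' ∀' ((addTerm (addTerm &0 &1) &2) =' (addTerm &0 (addTerm &1 &2)))
  have h : ZX α t ⊨ φ := by
    simp only [φ, Sentence.Realize, Formula.Realize, BoundedFormula.realize_all,
      BoundedFormula.realize_bdEqual, realize_addTerm_int]
    intro a b c
    exact add_assoc _ _ _
  have h' := (G.emb.map_sentence φ).1 h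
  simp only [φ, Sentence.Realize, Formula.Realize, BoundedFormula.realize_all,
    BoundedFormula.realize_bdEqual, realize_addTerm] at h'
  exact h' x y z

theorem op_comm (G : ElemExt.{u} α t) (x y : G) : G.op x y = G.op y x := by
  let φ : Lang.Sentence := ∀' ∀' ((addTerm &0 &1) =' (addTerm &1 &0))
  have h : ZX α t ⊨ φ := by
    simp only [φ, Sentence.Realize, Formula.Realize, BoundedFormula.realize_all,
      BoundedFormula.realize_bdEqual, realize_addTerm_int]
    intro a b
    exact add_comm _ _
  have h' := (G.emb.map_sentence φ).1 h
  simp only [φ, Sentence.Realize, Formula.Realize, BoundedFormula.realize_all,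
    BoundedFormula.realize_bdEqual, realize_addTerm] at h'
  exact h' x y

/-- The neutral element of an elementary extension. -/
def zero (G : ElemExt.{u} α t) : G := G.emb 0

theorem zero_op (G : ElemExt.{u} α t) (x : G) : G.op G.zero x = x := by
  let φ : Lang.Formula (Fin 1) := ∀' ((addTerm (Term.var (Sum.inl 0)) &0) =' &0)
  have h : φ.Realize (fun _ => 0 : Fin 1 → ZX α t) := by
    simp only [φ, Formula.Realize, BoundedFormula.realize_all,
      BoundedFormula.realize_bdEqual, realize_addTerm_int]
    intro a
    exact zero_add _
  have h' := (G.emb.map_formula φ _).2 h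
  simp only [φ, Formula.Realize, BoundedFormula.realize_all,
    BoundedFormula.realize_bdEqual, realize_addTerm] at h'
  exact h' x

theorem exists_neg (G : ElemExt.{u} α t) (x : G) : ∃ y, G.op y x = G.zero := by
  let φ : Lang.Formula (Fin 1) := ∀' ∃' ((addTerm &1 &0) =' Term.var (Sum.inl 0))
  have h : φ.Realize (fun _ => 0 : Fin 1 → ZX α t) := by
    simp only [φ, Formula.Realize, BoundedFormula.realize_all, BoundedFormula.realize_ex,
      BoundedFormula.realize_bdEqual, realize_addTerm_int]
    intro a
    exact ⟨-a, neg_add_cancel a⟩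
  have h' := (G.emb.map_formula φ _).2 h
  simp only [φ, Formula.Realize, BoundedFormula.realize_all, BoundedFormula.realize_ex,
    BoundedFormula.realize_bdEqual, realize_addTerm] at h'
  exact h' x

/-- An elementary extension of `(ℤ, +, X_α(t))` is an abelian group under its own addition. -/
noncomputable instance instAddCommGroup (G : ElemExt.{u} α t) : AddCommGroup G :=
  letI : Add G := ⟨G.op⟩
  letI : Zero G := ⟨G.zero⟩
  letI : Neg G := ⟨fun x => (G.exists_neg x).choose⟩
  { add_assoc := G.op_assoc
    zero_add := G.zero_op
    add_zero := fun x => (G.op_comm x G.zero).trans (G.zero_op x)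
    neg_add_cancel := fun x => (G.exists_neg x).choose_spec
    add_comm := G.op_comm
    nsmul := nsmulRec
    zsmul := zsmulRec }

/-- `G` is a sufficiently saturated extension, with respect to the cardinal `κ`. The requirement
that `κ` is sufficiently big is `2^ℵ₀ < κ`, the language being countable. -/
structure IsSufficientlySaturated (G : ElemExt.{u} α t) (κ : Cardinal.{u}) : Prop where
  big : 2 ^ ℵ₀ < κ
  saturated : IsSaturated Lang G κ
  homogeneous : IsStronglyHomogeneous Lang G κ

/-- The interpretation in `G` of the set `X_α(s)`, regarded as a subset of `(ℤ, +, X_α(t))`. -/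
def XStar (G : ElemExt.{u} α t) (s : ℝ) : Set G :=
  interpretation Lang (M := ZX α t) G (X α s)

end ElemExt

end IntExpansion

/-! Definability. On `ℝ/ℤ` one has `‖k • y‖ = k‖y‖` as long as `k • y` does not wrap around the
circle. From `X_α(t)` one first defines an arc of radius `r < 1/3`. Such an arc can be divided by
any `N` (keep the `x` whose multiples `x, ..., N • x` stay in it) and multiplied by any `j` (sum
sets), so arcs of radius `q * r` are definable for every rational `q > 0`. These operations control
a set only up to the boundary of its arc (`IsArc`), but that suffices: if `W` is an arc of radius in
`[t/n, (1-t)/n)`, then `x ∈ W` rules out wrapping, and `n • x ∈ X_α(t)` then says exactly that `x ∈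
X_α(t/n)`.

Components. A finite-index subgroup `H` contains the multiples of its index, and each `nℤ*` is
itself `∅`-definable of finite index; this gives `⋂ nℤ*` for every `A`. The group `Gt` is closed
under subtraction because differences from `X_α(t/2n)` lie in `X_α(t/n)`. It is proper because
multiples of `n` are still dense on the circle.

Bounded index. There are only countably many `∅`-definable generic sets (finitely many translates
cover). If `x` and `y` share a translate of each of them, then `x - y` lies in every
`∅`-type-definable subgroup of bounded index. The criterion does not mention the subgroup, so it
passes to the intersection of them all, whose index is therefore at most `2 ^ ℵ₀`. -/

namespace IntExpansion

/-! ### Transfer between `ℤ` and its elementary extension, by pairs of sets cut out by one formula.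
-/

section Correspondence

variable {α t : ℝ}

/-- Some formula of the language defines `P` in `(ℤ, +, X_α(t))` and `Q` in its extension `G`. -/
def SameFormula (G : ElemExt.{u} α t) {β : Type} (P : (β → ZX α t) → Prop)
    (Q : (β → G) → Prop) : Prop :=
  ∃ φ : Lang.Formula β, (∀ v, φ.Realize v ↔ P v) ∧ ∀ v, φ.Realize v ↔ Q v

/-- Some term of the language has the value `f` in `(ℤ, +, X_α(t))` and `g` in its
extension `G`. -/
def SameTerm (G : ElemExt.{u} α t) {β : Type} (f : (β → ZX α t) → ZX α t)
    (g : (β → G) → G) : Prop :=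
  ∃ τ : Lang.Term β, (∀ v, τ.realize v = f v) ∧ ∀ v, τ.realize v = g v

/-- Some formula in one variable defines `S` in `(ℤ, +, X_α(t))` and `S'` in its
extension `G`. -/
def SameSet (G : ElemExt.{u} α t) (S : Set (ZX α t)) (S' : Set G) : Prop :=
  SameFormula G (fun v : Fin 1 → ZX α t => v 0 ∈ S) (fun v : Fin 1 → G => v 0 ∈ S')

variable {G : ElemExt.{u} α t} {β : Type}

theorem eq_const_apply_zero {M : Type*} (v : Fin 1 → M) : v = fun _ => v 0 :=
  funext fun i => by rw [Subsingleton.elim i 0]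

theorem SameTerm.var (i : β) : SameTerm G (fun v => v i) (fun v => v i) :=
  ⟨Term.var i, fun _ => rfl, fun _ => rfl⟩

theorem SameTerm.add {f₁ f₂ : (β → ZX α t) → ZX α t} {g₁ g₂ : (β → G) → G}
    (h₁ : SameTerm G f₁ g₁) (h₂ : SameTerm G f₂ g₂) :
    SameTerm G (fun v => f₁ v + f₂ v) (fun v => g₁ v + g₂ v) := by
  obtain ⟨τ, hτ, hτ'⟩ := h₁
  obtain ⟨σ, hσ, hσ'⟩ := h₂
  refine ⟨ElemExt.addTerm τ σ, fun v => ?_, fun v => ?_⟩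
  · rw [ElemExt.realize_addTerm_int, hτ, hσ]
  · rw [ElemExt.realize_addTerm, hτ', hσ']
    rfl

theorem SameTerm.nsmul {f : (β → ZX α t) → ZX α t} {g : (β → G) → G}
    (h : SameTerm G f g) (n : ℕ) (hn : 1 ≤ n) :
    SameTerm G (fun v => n • f v) (fun v => n • g v) := by
  induction n, hn using Nat.le_induction with
  | base => simpa only [one_nsmul] using h
  | succ n _ ih => simpa only [succ_nsmul] using ih.add h

theorem SameTerm.eq {f₁ f₂ : (β → ZX α t) → ZX α t} {g₁ g₂ : (β → G) → G}
    (h₁ : SameTerm G f₁ g₁) (h₂ : SameTerm G f₂ g₂) :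
    SameFormula G (fun v => f₁ v = f₂ v) (fun v => g₁ v = g₂ v) := by
  obtain ⟨τ, hτ, hτ'⟩ := h₁
  obtain ⟨σ, hσ, hσ'⟩ := h₂
  exact ⟨τ.equal σ, fun v => by rw [Formula.realize_equal, hτ, hσ],
    fun v => by rw [Formula.realize_equal, hτ', hσ']⟩

theorem SameSet.mem {S : Set (ZX α t)} {S' : Set G} (h : SameSet G S S')
    {f : (β → ZX α t) → ZX α t} {g : (β → G) → G} (hf : SameTerm G f g) :
    SameFormula G (fun v => f v ∈ S) (fun v => g v ∈ S') := by
  obtain ⟨φ, hφ, hφ'⟩ := h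
  obtain ⟨τ, hτ, hτ'⟩ := hf
  refine ⟨BoundedFormula.subst φ (fun _ => τ), fun v => ?_, fun v => ?_⟩
  · refine BoundedFormula.realize_subst.trans ((hφ _).trans ?_)
    simp only [hτ]
  · refine BoundedFormula.realize_subst.trans ((hφ' _).trans ?_)
    simp only [hτ']

theorem sameSet_pred (G : ElemExt.{u} α t) : ∃ S' : Set G, SameSet G (X α t : Set ℤ) S' :=
  ⟨{x | (Relations.formula₁ (L := Lang) Rel.pred (Term.var (0 : Fin 1))).Realize fun _ => x},
    Relations.formula₁ (L := Lang) Rel.pred (Term.var 0),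
    fun _ => Formula.realize_rel₁, fun v => by
      change _ ↔ Formula.Realize _ fun _ => v 0
      rw [← eq_const_apply_zero v]⟩

namespace SameFormula

variable {P P₁ P₂ : (β → ZX α t) → Prop} {Q Q₁ Q₂ : (β → G) → Prop}

theorem not (h : SameFormula G P Q) : SameFormula G (fun v => ¬ P v) (fun v => ¬ Q v) := by
  obtain ⟨φ, hφ, hφ'⟩ := h
  exact ⟨φ.not, fun v => by rw [Formula.realize_not, hφ], fun v => by rw [Formula.realize_not, hφ']⟩

theorem and (h₁ : SameFormula G P₁ Q₁) (h₂ : SameFormula G P₂ Q₂) :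
    SameFormula G (fun v => P₁ v ∧ P₂ v) (fun v => Q₁ v ∧ Q₂ v) := by
  obtain ⟨φ, hφ, hφ'⟩ := h₁
  obtain ⟨ψ, hψ, hψ'⟩ := h₂
  exact ⟨φ ⊓ ψ, fun v => by rw [Formula.realize_inf, hφ, hψ],
    fun v => by rw [Formula.realize_inf, hφ', hψ']⟩

theorem imp (h₁ : SameFormula G P₁ Q₁) (h₂ : SameFormula G P₂ Q₂) :
    SameFormula G (fun v => P₁ v → P₂ v) (fun v => Q₁ v → Q₂ v) := by
  obtain ⟨φ, hφ, hφ'⟩ := h₁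
  obtain ⟨ψ, hψ, hψ'⟩ := h₂
  exact ⟨φ.imp ψ, fun v => by rw [Formula.realize_imp, hφ, hψ],
    fun v => by rw [Formula.realize_imp, hφ', hψ']⟩

theorem exists_index {ι : Type} [Finite ι] {P : ι → (β → ZX α t) → Prop} {Q : ι → (β → G) → Prop}
    (h : ∀ i, SameFormula G (P i) (Q i)) :
    SameFormula G (fun v => ∃ i, P i v) (fun v => ∃ i, Q i v) := by
  choose φ hφ hφ' using h
  exact ⟨Formula.iSup φ, fun v => by simp only [Formula.realize_iSup, hφ],
    fun v => by simp only [Formula.realize_iSup, hφ']⟩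

theorem ex {P : (β ⊕ Unit → ZX α t) → Prop} {Q : (β ⊕ Unit → G) → Prop}
    (h : SameFormula G P Q) :
    SameFormula G (fun v => ∃ x, P (Sum.elim v fun _ => x))
      (fun v => ∃ x, Q (Sum.elim v fun _ => x)) := by
  obtain ⟨φ, hφ, hφ'⟩ := h
  refine ⟨φ.iExs Unit, fun v => ?_, fun v => ?_⟩
  · rw [Formula.realize_iExs]
    exact ⟨fun ⟨i, hi⟩ => ⟨i (), (hφ _).1 hi⟩, fun ⟨x, hx⟩ => ⟨fun _ => x, (hφ _).2 hx⟩⟩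
  · rw [Formula.realize_iExs]
    exact ⟨fun ⟨i, hi⟩ => ⟨i (), (hφ' _).1 hi⟩, fun ⟨x, hx⟩ => ⟨fun _ => x, (hφ' _).2 hx⟩⟩

theorem all {P : (β ⊕ Unit → ZX α t) → Prop} {Q : (β ⊕ Unit → G) → Prop}
    (h : SameFormula G P Q) :
    SameFormula G (fun v => ∀ x, P (Sum.elim v fun _ => x))
      (fun v => ∀ x, Q (Sum.elim v fun _ => x)) := by
  simpa only [not_exists, not_not] using h.not.ex.not

theorem iff_emb (h : SameFormula G P Q) (v : β → ZX α t) : P v ↔ Q (G.emb ∘ v) := by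
  obtain ⟨φ, hφ, hφ'⟩ := h
  rw [← hφ, ← hφ', G.emb.map_formula]

/-- With finitely many variables the universal closure is a sentence, so elementarity carries it to
points of `G` outside the image of `ℤ`. -/
theorem forall_of_forall [Finite β] (h : SameFormula G P Q) (hP : ∀ v, P v) (v : β → G) : Q v := by
  obtain ⟨φ, hφ, hφ'⟩ := h
  have hZ : (Formula.iAlls β (φ.relabel (Sum.inr : β → Empty ⊕ β))).Realize
      (default : Empty → ZX α t) := by
    rw [Formula.realize_iAlls]
    exact fun w => Formula.realize_relabel.2 ((hφ _).2 (hP _))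
  rw [← G.emb.map_formula, Formula.realize_iAlls] at hZ
  exact (hφ' v).1 ((Formula.realize_relabel (g := Sum.inr)).1 (hZ v))

/-- Fixing a parameter in a formula. -/
theorem definable_fiber {P : (Fin 1 ⊕ Unit → ZX α t) → Prop} {Q : (Fin 1 ⊕ Unit → G) → Prop}
    (h : SameFormula G P Q) {A : Set G} {b : G} (hb : b ∈ A) :
    A.Definable₁ Lang {x | Q (Sum.elim (fun _ => x) fun _ => b)} := by
  obtain ⟨φ, hφ, hφ'⟩ := h
  refine Set.definable_iff_exists_formula_sum.2
    ⟨φ.relabel (Sum.elim Sum.inr fun _ => Sum.inl ⟨b, hb⟩), ?_⟩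
  ext v
  change Q _ ↔ Formula.Realize _ _
  rw [Formula.realize_relabel, hφ']
  have : (Sum.elim (fun _ => v 0) fun _ => b : Fin 1 ⊕ Unit → G) =
      Sum.elim (fun a : A => (a : G)) v ∘ Sum.elim Sum.inr fun _ => Sum.inl ⟨b, hb⟩ := by
    ext (i | i)
    · rw [Subsingleton.elim i 0]
      rfl
    · rfl
  rw [← this]

end SameFormula

namespace SameSet

variable {S T : Set (ZX α t)} {S' T' : Set G}

theorem of_definable_ext (h : (∅ : Set G).Definable₁ Lang S') : ∃ S, SameSet G S S' := by
  obtain ⟨φ, hφ⟩ := Set.empty_definable_iff.1 h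
  refine ⟨{x | φ.Realize fun _ => x}, φ, fun v => ?_, fun v => ?_⟩
  · change _ ↔ φ.Realize fun _ => v 0
    rw [← eq_const_apply_zero v]
  · exact (Set.ext_iff.1 hφ v).symm

theorem definable (h : SameSet G S S') : (∅ : Set (ZX α t)).Definable₁ Lang S := by
  obtain ⟨φ, hφ, -⟩ := h
  exact Set.empty_definable_iff.2 ⟨φ, Set.ext fun v => (hφ v).symm⟩

theorem definable_ext (h : SameSet G S S') : (∅ : Set G).Definable₁ Lang S' := by
  obtain ⟨φ, -, hφ⟩ := h
  exact Set.empty_definable_iff.2 ⟨φ, Set.ext fun v => (hφ v).symm⟩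

theorem interpretation_eq (h : SameSet G S S') :
    interpretation Lang (M := ZX α t) G S = S' := by
  obtain ⟨φ, hφ, hφ'⟩ := h
  ext x
  constructor
  · rintro ⟨ψ, hψ, hx⟩
    -- A second formula `ψ` defining `S` in `ℤ` implies the first one there, hence also in `G`.
    refine (SameFormula.forall_of_forall (G := G)
      (P := fun v : Fin 1 → ZX α t => ψ.Realize v → v 0 ∈ S)
      (Q := fun v : Fin 1 → G => ψ.Realize v → v 0 ∈ S') ?_ (fun v hv => ?_) (fun _ => x)) hx
    · exact SameFormula.imp ⟨ψ, fun _ => Iff.rfl, fun _ => Iff.rfl⟩ ⟨φ, hφ, hφ'⟩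
    · rw [hψ]
      change ψ.Realize fun _ => v 0
      rwa [← eq_const_apply_zero v]
  · exact fun hx => ⟨φ, Set.ext fun a => (hφ fun _ => a).symm, (hφ' _).2 hx⟩

theorem zero_mem (h : SameSet G S S') (h0 : 0 ∈ S) : (0 : G) ∈ S' :=
  (h.iff_emb fun _ => 0).1 h0

theorem sub_mem (hS : SameSet G S S') (hT : SameSet G T T')
    (h : ∀ x ∈ S, ∀ y ∈ S, x - y ∈ T) : ∀ x ∈ S', ∀ y ∈ S', x - y ∈ T' := by
  intro x hx y hy
  -- The language has no subtraction: the difference is a third variable `z` with `z + y = x`.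
  have := SameFormula.forall_of_forall (((hS.mem (.var (0 : Fin 3))).and
    (hS.mem (.var 1))).imp (((SameTerm.var 2).add (.var 1)).eq (.var 0) |>.imp
      (hT.mem (.var 2)))) ?_ ![x, y, x - y]
  · exact this ⟨hx, hy⟩ (sub_add_cancel x y)
  · rintro v ⟨h0, h1⟩ h2
    rw [← sub_eq_of_eq_add h2.symm]
    exact h _ h0 _ h1

/-- For a fixed finite number of translates, covering the group is a first-order property of the
tuple `c`. -/
theorem exists_sub_mem (hS : SameSet G S S') {K : ℕ} (c : Fin K → ZX α t)
    (h : ∀ x, ∃ i, x - c i ∈ S) : ∀ x, ∃ i, x - G.emb (c i) ∈ S' := by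
  intro x
  have := (SameFormula.all (β := Fin K) (SameFormula.exists_index fun i =>
    ((hS.mem (.var (.inr ()))).and ((((SameTerm.var (.inr ())).add
      (.var (.inl (.inl i)))).eq (.var (.inl (.inr ()))) ))).ex)).iff_emb c |>.1 ?_
  · obtain ⟨i, y, hy, hxy⟩ := this x
    refine ⟨i, ?_⟩
    have hxy' : y + G.emb (c i) = x := hxy
    rwa [← hxy', add_sub_cancel_right]
  · intro x
    obtain ⟨i, hi⟩ := h x
    exact ⟨i, x - c i, hi, sub_add_cancel x (c i)⟩

theorem inter (hS : SameSet G S S') (hT : SameSet G T T') : SameSet G (S ∩ T) (S' ∩ T') :=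
  SameFormula.and hS hT

theorem univ : SameSet G Set.univ Set.univ :=
  ⟨⊤, fun _ => by simp, fun _ => by simp⟩

theorem add (hS : SameSet G S S') (hT : SameSet G T T') :
    SameSet G {x | ∃ y, y ∈ S ∧ ∃ z, z ∈ T ∧ y + z = x}
      {x | ∃ y, y ∈ S' ∧ ∃ z, z ∈ T' ∧ y + z = x} := by
  have hy := SameTerm.var (G := G) (Sum.inl (Sum.inr ()) : (Fin 1 ⊕ Unit) ⊕ Unit)
  have hz := SameTerm.var (G := G) (Sum.inr () : (Fin 1 ⊕ Unit) ⊕ Unit)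
  have hx := SameTerm.var (G := G) (Sum.inl (Sum.inl 0) : (Fin 1 ⊕ Unit) ⊕ Unit)
  have hy' := SameTerm.var (G := G) (Sum.inr () : Fin 1 ⊕ Unit)
  exact ((hS.mem hy').and ((hT.mem hz).and ((hy.add hz).eq hx)).ex).ex

theorem nsmul_preimage (hS : SameSet G S S') (n : ℕ) (hn : 1 ≤ n) :
    SameSet G {x | n • x ∈ S} {x | n • x ∈ S'} :=
  hS.mem ((SameTerm.var (0 : Fin 1)).nsmul n hn)

theorem range_nsmul (G : ElemExt.{u} α t) (n : ℕ) (hn : 1 ≤ n) :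
    SameSet G (Set.range fun y => n • y) (Set.range fun y => n • y) := by
  have hy := SameTerm.var (G := G) (Sum.inr () : Fin 1 ⊕ Unit)
  have hx := SameTerm.var (G := G) (Sum.inl 0 : Fin 1 ⊕ Unit)
  exact ((hy.nsmul n hn).eq hx).ex

theorem exists_add_notMem (hS : SameSet G S S') :
    SameSet G {m | ∃ n, n ∉ S ∧ n + m ∉ S} {m | ∃ n, n ∉ S' ∧ n + m ∉ S'} := by
  have hn := SameTerm.var (G := G) (Sum.inr () : Fin 1 ⊕ Unit)
  have hm := SameTerm.var (G := G) (Sum.inl 0 : Fin 1 ⊕ Unit)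
  exact ((hS.mem hn).not.and (hS.mem (hn.add hm)).not).ex

end SameSet

end Correspondence

end IntExpansion
namespace IntExpansion

/-! ### The norm on the circle and multiples without wrapping. -/

section Circle

theorem min_abs_le_norm_coe (x : ℝ) : min |x| (1 - |x|) ≤ ‖(x : UnitAddCircle)‖ := by
  rw [UnitAddCircle.norm_eq]
  rcases eq_or_ne (round x) 0 with h | h
  · simp [h]
  · refine (min_le_right _ _).trans ?_
    have h1 : (1 : ℝ) ≤ |(round x : ℝ)| := by
      exact_mod_cast Int.one_le_abs h
    have h2 := abs_sub_abs_le_abs_sub (round x : ℝ) x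
    rw [abs_sub_comm] at h2
    linarith

theorem norm_coe_le_abs (x : ℝ) : ‖(x : UnitAddCircle)‖ ≤ |x| := by
  rw [UnitAddCircle.norm_eq]
  simpa using round_le x 0

theorem exists_coe_eq_abs_eq_norm (y : UnitAddCircle) :
    ∃ x : ℝ, (x : UnitAddCircle) = y ∧ |x| = ‖y‖ := by
  induction y using QuotientAddGroup.induction_on with
  | H x =>
    refine ⟨x - round x, ?_, (UnitAddCircle.norm_eq).symm⟩
    have : ((round x : ℝ) : UnitAddCircle) = 0 :=
      (AddCircle.coe_eq_zero_iff 1).2 ⟨round x, by simp⟩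
    rw [AddCircle.coe_sub, this, sub_zero]

theorem norm_le_half (y : UnitAddCircle) : ‖y‖ ≤ 1 / 2 := by
  simpa using AddCircle.norm_le_half_period (p := 1) (x := y) one_ne_zero

/-- No wrapping around the circle takes place for `k • y` if `k * ‖y‖ < 1 - ‖k • y‖`. -/
theorem nsmul_norm_le (y : UnitAddCircle) (k : ℕ) (h : k * ‖y‖ < 1 - ‖k • y‖) :
    k * ‖y‖ ≤ ‖k • y‖ := by
  obtain ⟨x, rfl, hx⟩ := exists_coe_eq_abs_eq_norm y
  have := min_abs_le_norm_coe (k * x)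
  rw [abs_mul, Nat.abs_cast, hx, ← nsmul_eq_mul k x, AddCircle.coe_nsmul, min_le_iff] at this
  rcases this with h' | h'
  · exact h'
  · linarith

theorem norm_le_div_of_forall_nsmul {r : ℝ} (hr : r < 1 / 3) (y : UnitAddCircle) (N : ℕ)
    (hN : 1 ≤ N) (h : ∀ k, 1 ≤ k → k ≤ N → ‖k • y‖ ≤ r) : N * ‖y‖ ≤ r := by
  induction N, hN using Nat.le_induction with
  | base => simpa using h 1 le_rfl le_rfl
  | succ N hN ih =>
    have ih := ih fun k h1 h2 => h k h1 (h2.trans N.le_succ)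
    have h1 := h 1 le_rfl (by omega)
    have h2 := h (N + 1) (by omega) le_rfl
    rw [one_nsmul] at h1
    -- By induction `(N + 1)‖y‖ ≤ r + r < 1 - r`, so the next multiple cannot wrap; this is where `r
    -- < 1/3` enters.
    refine (nsmul_norm_le y (N + 1) ?_).trans h2
    push_cast
    linarith

theorem norm_half : ‖((1 / 2 : ℝ) : UnitAddCircle)‖ = 1 / 2 := by
  simpa using AddCircle.norm_half_period_eq (p := (1 : ℝ))

theorem norm_sub_half_le (y : UnitAddCircle) :
    ‖y - ((1 / 2 : ℝ) : UnitAddCircle)‖ ≤ 1 / 2 - ‖y‖ := by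
  have hy := norm_le_half y
  obtain ⟨x, rfl, hx⟩ := exists_coe_eq_abs_eq_norm y
  rw [← hx] at hy ⊢
  rcases le_total 0 x with h | h
  · rw [← AddCircle.coe_sub]
    refine (norm_coe_le_abs _).trans ?_
    rw [abs_of_nonneg h] at *
    rw [abs_of_nonpos] <;> linarith
  · have : ((1 / 2 : ℝ) : UnitAddCircle) = ((-(1 / 2) : ℝ) : UnitAddCircle) := by
      rw [← sub_eq_zero, ← AddCircle.coe_sub]
      exact (AddCircle.coe_eq_zero_iff 1).2 ⟨1, by norm_num⟩
    rw [this, ← AddCircle.coe_sub]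
    refine (norm_coe_le_abs _).trans ?_
    rw [abs_of_nonpos h] at *
    rw [abs_of_nonneg] <;> linarith

end Circle

/-! ### Arcs pulled back to `ℤ` along an irrational rotation. -/

section Rotation

variable {α : ℝ}

theorem rot_eq_zsmul (α : ℝ) (n : ℤ) : rot α n = n • (α : UnitAddCircle) := by
  rw [rot, ← zsmul_eq_mul, AddCircle.coe_zsmul]

theorem rot_add (m n : ℤ) : rot α (m + n) = rot α m + rot α n := by
  simp only [rot_eq_zsmul, add_zsmul]

theorem rot_sub (m n : ℤ) : rot α (m - n) = rot α m - rot α n := by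
  rw [rot_eq_zsmul, sub_zsmul, rot_eq_zsmul, rot_eq_zsmul, sub_eq_add_neg]

theorem rot_nsmul (k : ℕ) (n : ℤ) : rot α (k • n) = k • rot α n := by
  simp only [rot_eq_zsmul, ← natCast_zsmul, smul_eq_mul, mul_zsmul]

theorem mem_X_iff {s : ℝ} {n : ℤ} : n ∈ X α s ↔ ‖rot α n‖ < s := by
  constructor
  · rintro ⟨x, hx, h⟩
    rw [← h]
    exact (norm_coe_le_abs x).trans_lt (abs_lt.2 hx)
  · intro h
    obtain ⟨x, hx, hx'⟩ := exists_coe_eq_abs_eq_norm (rot α n)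
    exact ⟨x, abs_lt.1 (hx' ▸ h), hx⟩

theorem exists_norm_rot_sub_lt (hα : Irrational α) (y : UnitAddCircle) {ε : ℝ} (hε : 0 < ε) :
    ∃ n, ‖rot α n - y‖ < ε := by
  have hd : DenseRange (· • (α : UnitAddCircle) : ℤ → UnitAddCircle) :=
    AddCircle.denseRange_zsmul_coe_iff.2 (by simpa using hα)
  obtain ⟨z, ⟨n, rfl⟩, hz⟩ := Dense.exists_dist_lt hd y hε
  refine ⟨n, ?_⟩
  rw [rot_eq_zsmul, ← dist_eq_norm, dist_comm]
  exact hz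

theorem exists_rot_cover (hα : Irrational α) {s : ℝ} (hs : 0 < s) :
    ∃ (K : ℕ) (c : Fin K → ℤ), ∀ n : ℤ, ∃ i, n - c i ∈ X α s := by
  obtain ⟨F, hF⟩ := isCompact_univ.elim_finite_subcover
    (fun i : ℤ => Metric.ball (rot α i) s) (fun _ => Metric.isOpen_ball) (fun y _ => by
      obtain ⟨n, hn⟩ := exists_norm_rot_sub_lt hα y hs
      rw [← dist_eq_norm, dist_comm] at hn
      exact Set.mem_iUnion.2 ⟨n, hn⟩)
  refine ⟨F.card, fun i => F.equivFin.symm i, fun n => ?_⟩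
  have := hF (Set.mem_univ (rot α n))
  simp only [Set.mem_iUnion] at this
  obtain ⟨i, hi, h⟩ := this
  refine ⟨F.equivFin ⟨i, hi⟩, ?_⟩
  beta_reduce
  rw [Equiv.symm_apply_apply, mem_X_iff, rot_sub, ← dist_eq_norm]
  exact h

/-- `D` is sandwiched between the preimages of the open and of the closed arc of radius `r`. -/
def IsArc (α r : ℝ) (D : Set ℤ) : Prop :=
  (∀ n, ‖rot α n‖ < r → n ∈ D) ∧ ∀ n ∈ D, ‖rot α n‖ ≤ r

theorem IsArc.add (hα : Irrational α) {a b : ℝ} (ha : 0 < a) (hb : 0 < b) {D E : Set ℤ}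
    (hD : IsArc α a D) (hE : IsArc α b E) :
    IsArc α (a + b) {x | ∃ y, y ∈ D ∧ ∃ z, z ∈ E ∧ y + z = x} := by
  constructor
  · intro n hn
    obtain ⟨x, hx, hx'⟩ := exists_coe_eq_abs_eq_norm (rot α n)
    rw [← hx'] at hn
    have hab : 0 < a + b := by positivity
    -- Split `x` in the ratio `a : b`. The parts have size at most `q * a` and `q * b`, and the
    -- slack `(1 - q) * a`, `(1 - q) * b` pays for replacing the first part by an integer's orbit
    -- point.
    set q := |x| / (a + b) with hq
    have hq1 : q < 1 := (div_lt_one hab).2 hn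
    have hxq : |x| = q * (a + b) := (div_mul_cancel₀ _ hab.ne').symm
    set u : UnitAddCircle := ((x * (a / (a + b)) : ℝ) : UnitAddCircle) with hu
    have hu1 : ‖u‖ ≤ q * a := by
      refine (norm_coe_le_abs _).trans ?_
      rw [abs_mul, abs_of_pos (div_pos ha hab), hxq]
      field_simp
      rfl
    have hu2 : ‖rot α n - u‖ ≤ q * b := by
      rw [← hx, hu, ← AddCircle.coe_sub]
      refine (norm_coe_le_abs _).trans ?_
      have : x - x * (a / (a + b)) = x * (b / (a + b)) := by
        field_simp
        ring
      rw [this, abs_mul, abs_of_pos (div_pos hb hab), hxq]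
      field_simp
      rfl
    have hε : 0 < min ((1 - q) * a) ((1 - q) * b) := by
      have := sub_pos.2 hq1
      positivity
    obtain ⟨m, hm⟩ := exists_norm_rot_sub_lt hα u hε
    obtain ⟨hm1, hm2⟩ := lt_min_iff.1 hm
    refine ⟨m, hD.1 m ?_, n - m, hE.1 _ ?_, add_sub_cancel m n⟩
    · calc ‖rot α m‖ = ‖(rot α m - u) + u‖ := by rw [sub_add_cancel]
        _ ≤ _ := norm_add_le _ _
        _ < a := by linarith
    · calc ‖rot α (n - m)‖ = ‖(rot α n - u) - (rot α m - u)‖ := by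
            rw [rot_sub, sub_sub_sub_cancel_right]
        _ ≤ _ := norm_sub_le _ _
        _ < b := by linarith
  · rintro _ ⟨y, hy, z, hz, rfl⟩
    rw [rot_add]
    exact (norm_add_le _ _).trans (add_le_add (hD.2 y hy) (hE.2 z hz))

theorem IsArc.forall_nsmul {r : ℝ} (hr : r < 1 / 3) {D : Set ℤ} (hD : IsArc α r D) (N : ℕ)
    (hN : 1 ≤ N) : IsArc α (r / N) {x : ℤ | ∀ k, 1 ≤ k → k ≤ N → k • x ∈ D} := by
  have hN0 : (0 : ℝ) < N := by exact_mod_cast hN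
  constructor
  · intro n hn k _ hk
    refine hD.1 _ ?_
    rw [lt_div_iff₀ hN0] at hn
    rw [rot_nsmul]
    refine (norm_nsmul_le).trans_lt (lt_of_le_of_lt ?_ hn)
    rw [mul_comm]
    have : (k : ℝ) ≤ N := by exact_mod_cast hk
    gcongr
  · intro n hn
    rw [le_div_iff₀ hN0, mul_comm]
    refine norm_le_div_of_forall_nsmul hr _ N hN fun k h1 h2 => ?_
    rw [← rot_nsmul]
    exact hD.2 _ (hn k h1 h2)

/-- The complement of `X_α(t)` is a closed arc of radius `1/2 - t` about `1/2`; its difference set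
doubles that radius. -/
theorem isArc_exists_add_notMem (hα : Irrational α) {t : ℝ} :
    IsArc α (1 - 2 * t) {m | ∃ n, n ∉ X α t ∧ n + m ∉ X α t} := by
  simp only [mem_X_iff, not_lt]
  constructor
  · intro m hm
    obtain ⟨x, hx, hx'⟩ := exists_coe_eq_abs_eq_norm (rot α m)
    rw [← hx'] at hm
    set h : UnitAddCircle := ((1 / 2 : ℝ) : UnitAddCircle)
    set u : UnitAddCircle := ((x / 2 : ℝ) : UnitAddCircle)
    have hu : ‖u‖ ≤ |x| / 2 := (norm_coe_le_abs _).trans_eq (by rw [abs_div, abs_two])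
    have huu : rot α m = u + u := by rw [← hx, ← AddCircle.coe_add, add_halves]
    have hh : ‖h‖ = 1 / 2 := norm_half
    -- Place the two points symmetrically about `1/2`, near `h - u` and `h + u`.
    obtain ⟨n, hn⟩ := exists_norm_rot_sub_lt hα (h - u) (ε := 1 / 2 - |x| / 2 - t) (by linarith)
    refine ⟨n, ?_, ?_⟩
    · have : h = rot α n - (rot α n - (h - u)) + u := by abel
      have h1 := norm_add_le (rot α n - (rot α n - (h - u))) u
      have h2 := norm_sub_le (rot α n) (rot α n - (h - u))
      rw [← this] at h1
      linarith
    · have : h = rot α (n + m) - (rot α n - (h - u)) - u := by rw [rot_add, huu]; abel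
      have h1 := norm_sub_le (rot α (n + m) - (rot α n - (h - u))) u
      have h2 := norm_sub_le (rot α (n + m)) (rot α n - (h - u))
      rw [← this] at h1
      linarith
  · rintro m ⟨n, h1, h2⟩
    set h : UnitAddCircle := ((1 / 2 : ℝ) : UnitAddCircle)
    have h3 : ‖rot α n - h‖ ≤ _ := norm_sub_half_le (rot α n)
    have h4 : ‖rot α (n + m) - h‖ ≤ _ := norm_sub_half_le (rot α (n + m))
    have h5 := norm_sub_le (rot α (n + m) - h) (rot α n - h)
    rw [sub_sub_sub_cancel_right, rot_add, add_sub_cancel_left] at h5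
    rw [rot_add] at h2 h4
    linarith

theorem isArc_inter_two_nsmul {t : ℝ} (ht : t ≤ 1 / 3) :
    IsArc α (t / 2) (X α t ∩ {n : ℤ | 2 • n ∈ X α t}) := by
  constructor
  · intro n hn
    refine ⟨mem_X_iff.2 (by linarith [norm_nonneg (rot α n)]), mem_X_iff.2 ?_⟩
    rw [rot_nsmul, two_nsmul]
    exact (norm_add_le _ _).trans_lt (by linarith)
  · rintro n ⟨h1, h2⟩
    have h2 : ‖rot α (2 • n)‖ < t := mem_X_iff.1 h2
    rw [mem_X_iff] at h1
    rw [rot_nsmul] at h2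
    -- No wrapping: `2‖y‖ + ‖2 • y‖ < 3t ≤ 1`.
    have := nsmul_norm_le (rot α n) 2 (by push_cast; linarith)
    push_cast at this
    linarith

/-- `X_α(t/n)` can be recovered from `X_α(t)` and a set close enough to it. -/
theorem X_div_eq_of_isArc {t r : ℝ} {n : ℕ} (hn : 1 ≤ n) (h1 : t / n ≤ r) (h2 : r < (1 - t) / n)
    {W : Set ℤ} (hW : IsArc α r W) : X α (t / n) = W ∩ {x : ℤ | n • x ∈ X α t} := by
  have hn0 : (0 : ℝ) < n := by exact_mod_cast hn
  ext x
  change _ ↔ x ∈ W ∧ n • x ∈ X α t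
  rw [mem_X_iff, mem_X_iff, rot_nsmul]
  constructor
  · intro h
    refine ⟨hW.1 x (h.trans_le h1), norm_nsmul_le.trans_lt ?_⟩
    rwa [lt_div_iff₀ hn0, mul_comm] at h
  · rintro ⟨hx, h⟩
    -- Together `n‖y‖ < 1 - t` and `‖n • y‖ < t` exclude wrapping.
    have hx := (hW.2 x hx).trans_lt h2
    rw [lt_div_iff₀ hn0, mul_comm] at hx ⊢
    exact (nsmul_norm_le _ _ (by linarith)).trans_lt h

end Rotation

/-! ### Definability of `X_α(t/n)`. -/

section Definability

variable {α t : ℝ} (G : ElemExt.{u} α t)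

theorem SameSet.exists_forall_nsmul {D : Set (ZX α t)} (hD : ∃ D' : Set G, SameSet G D D')
    (N : ℕ) :
    ∃ D' : Set G, SameSet G {x | ∀ k, 1 ≤ k → k ≤ N → k • x ∈ D} D' := by
  obtain ⟨D', hD⟩ := hD
  induction N with
  | zero =>
    refine ⟨Set.univ, ?_⟩
    convert SameSet.univ (G := G)
    exact Set.eq_univ_of_forall fun x k h1 h2 => by omega
  | succ N ih =>
    obtain ⟨E, hE⟩ := ih
    have h : {x : ZX α t | ∀ k, 1 ≤ k → k ≤ N + 1 → k • x ∈ D} =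
        {x | ∀ k, 1 ≤ k → k ≤ N → k • x ∈ D} ∩ {x | (N + 1) • x ∈ D} := by
      ext x
      constructor
      · exact fun h => ⟨fun k h1 h2 => h k h1 (by omega), h _ (by omega) le_rfl⟩
      · rintro ⟨h, h'⟩ k h1 h2
        rcases h2.eq_or_lt with rfl | h2
        · exact h'
        · exact h k h1 (by omega)
    rw [h]
    exact ⟨_, hE.inter (hD.nsmul_preimage (N + 1) (by omega))⟩

theorem exists_isArc_mul (hα : Irrational α) {r : ℝ} (hr : 0 < r) {D : Set ℤ}
    (hD : IsArc α r D) (hD' : ∃ D' : Set G, SameSet G D D') (j : ℕ) (hj : 1 ≤ j) :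
    ∃ E : Set ℤ, IsArc α (j * r) E ∧ ∃ E' : Set G, SameSet G E E' := by
  induction j, hj using Nat.le_induction with
  | base => exact ⟨D, by simpa using hD, hD'⟩
  | succ j hj ih =>
    obtain ⟨E, hE, E', hE'⟩ := ih
    obtain ⟨D', hD'⟩ := hD'
    have hj0 : (0 : ℝ) < j := by exact_mod_cast hj
    refine ⟨_, ?_, _, hE'.add hD'⟩
    have := hE.add hα (by positivity) hr hD
    rw [show (j : ℝ) * r + r = (j + 1 : ℕ) * r by push_cast; ring] at this
    exact this

theorem exists_small_isArc (hα : Irrational α) (ht0 : 0 < t) (ht : t < 1 / 2) :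
    ∃ r : ℝ, 0 < r ∧ r < 1 / 3 ∧ ∃ D : Set ℤ, IsArc α r D ∧ ∃ D' : Set G, SameSet G D D' := by
  obtain ⟨P, hP⟩ := sameSet_pred G
  rcases le_or_gt t (1 / 3) with h | h
  · exact ⟨t / 2, by linarith, by linarith, _, isArc_inter_two_nsmul h, _,
      hP.inter (hP.nsmul_preimage 2 (by norm_num))⟩
  · exact ⟨1 - 2 * t, by linarith, by linarith, _, isArc_exists_add_notMem hα, _,
      hP.exists_add_notMem⟩

theorem exists_sameSet_X (hα : Irrational α) (ht0 : 0 < t) (ht : t < 1 / 2) (n : ℕ) (hn : 1 ≤ n) :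
    ∃ S' : Set G, SameSet G (X α (t / n) : Set ℤ) S' := by
  have hn0 : (0 : ℝ) < n := by exact_mod_cast hn
  obtain ⟨r, hr0, hr, D, hD, hD'⟩ := exists_small_isArc G hα ht0 ht
  -- The window is nonempty because `t < 1/2`. The radius `q * r` is reached by dividing the arc by
  -- `q.den` and summing `q.num` copies.
  obtain ⟨q, hq1, hq2⟩ := exists_rat_btwn (show t / n / r < (1 - t) / n / r by gcongr; linarith)
  rw [div_lt_iff₀ hr0] at hq1
  rw [lt_div_iff₀ hr0] at hq2
  have hq0 : 0 < q := by
    have : (0 : ℝ) < q * r := lt_trans (by positivity) hq1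
    exact_mod_cast (pos_iff_pos_of_mul_pos this).2 hr0
  obtain ⟨E, hE, hE'⟩ := exists_isArc_mul G hα (div_pos hr0 (Nat.cast_pos.2 q.pos))
    (hD.forall_nsmul hr q.den q.pos) (SameSet.exists_forall_nsmul G hD' q.den) q.num.toNat
    (by have := Rat.num_pos.2 hq0; omega)
  have hqr : (q.num.toNat : ℝ) * (r / q.den) = q * r := by
    have : ((q.num.toNat : ℤ) : ℝ) = q.num := by rw [Int.toNat_of_nonneg (Rat.num_pos.2 hq0).le]
    rw [Int.cast_natCast] at this
    rw [this]
    nth_rw 3 [← Rat.num_div_den q]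
    push_cast
    ring
  rw [hqr] at hE
  obtain ⟨E', hE'⟩ := hE'
  obtain ⟨P, hP⟩ := sameSet_pred G
  rw [X_div_eq_of_isArc hn hq1.le hq2 hE]
  exact ⟨_, hE'.inter (hP.nsmul_preimage n hn)⟩

theorem sameSet_XStar (hα : Irrational α) (ht0 : 0 < t) (ht : t < 1 / 2) (n : ℕ) (hn : 1 ≤ n) :
    SameSet G (X α (t / n) : Set ℤ) (G.XStar (t / n)) := by
  obtain ⟨S', h⟩ := exists_sameSet_X G hα ht0 ht n hn
  have := h.interpretation_eq
  rw [ElemExt.XStar, this]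
  exact h

end Definability

end IntExpansion
namespace IntExpansion

/-! ### Consequences of saturation. -/

section Saturation

variable {L : FirstOrder.Language.{0, 0}} {M : Type u} [L.Structure M] {κ : Cardinal.{u}}

theorem IsSaturated.sInter_nonempty (h : IsSaturated L M κ) {A : Set M} (hA : #A < κ)
    {S : Set (Set M)} (hS : ∀ Y ∈ S, A.Definable₁ L Y)
    (hfin : ∀ T ⊆ S, T.Finite → (⋂₀ T).Nonempty) : (⋂₀ S).Nonempty := by
  obtain ⟨x, hx⟩ := h A hA {φ | {x | φ.Realize fun _ => x} ∈ S} (fun q hq hqf => by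
    obtain ⟨x, hx⟩ := hfin ((fun φ : L[[A]].Formula (Fin 1) => {x | φ.Realize fun _ => x}) '' q)
      (by rintro _ ⟨φ, hφ, rfl⟩; exact hq hφ) (hqf.image _)
    exact ⟨x, fun φ hφ => hx _ ⟨φ, hφ, rfl⟩⟩)
  refine ⟨x, fun Y hY => ?_⟩
  obtain ⟨φ, hφ⟩ := hS Y hY
  have hφ' : Y = {x | φ.Realize fun _ => x} :=
    Set.ext fun a => Set.ext_iff.1 hφ fun _ => a
  rw [hφ'] at hY ⊢
  exact hx φ hY

theorem IsSaturated.exists_forall_mem (h : IsSaturated L M κ) {A : Set M} (hA : #A < κ)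
    {𝓔 : Set (Set M)} (huniv : Set.univ ∈ 𝓔) (hinter : ∀ E ∈ 𝓔, ∀ E' ∈ 𝓔, E ∩ E' ∈ 𝓔)
    {f : Set M → Set M} (hf : Monotone f) (hdef : ∀ E ∈ 𝓔, A.Definable₁ L (f E))
    (hne : ∀ E ∈ 𝓔, (f E).Nonempty) : ∃ x, ∀ E ∈ 𝓔, x ∈ f E := by
  obtain ⟨x, hx⟩ := h.sInter_nonempty hA (S := f '' 𝓔) (by rintro _ ⟨E, hE, rfl⟩; exact hdef E hE)
    (fun T hT hTf => by
      have : ∃ E ∈ 𝓔, f E ⊆ ⋂₀ T := by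
        induction T, hTf using Set.Finite.induction_on with
        | empty => exact ⟨Set.univ, huniv, by simp⟩
        | @insert a T _ _ ih =>
          obtain ⟨E, hE, hET⟩ := ih ((Set.subset_insert _ _).trans hT)
          obtain ⟨E', hE', rfl⟩ := hT (Set.mem_insert _ _)
          refine ⟨E ∩ E', hinter E hE E' hE', ?_⟩
          rw [Set.sInter_insert]
          exact Set.subset_inter (hf Set.inter_subset_right)
            ((hf Set.inter_subset_left).trans hET)
      obtain ⟨E, hE, hET⟩ := this
      exact (hne E hE).mono hET)
  exact ⟨x, fun E hE => hx _ ⟨E, hE, rfl⟩⟩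

/-- A type-definable set is the intersection of all definable sets that contain it. -/
theorem IsTypeDefinable.mem_of_forall {A X : Set M} (h : IsTypeDefinable L A X) {x : M}
    (hx : ∀ Y, A.Definable₁ L Y → X ⊆ Y → x ∈ Y) : x ∈ X := by
  obtain ⟨S, hS, rfl⟩ := h
  exact fun Y hY => hx Y (hS Y hY) (Set.sInter_subset_of_mem hY)

end Saturation

/-! ### Generic sets and the index of subgroups. -/

section Generic

variable {M : Type u} [AddCommGroup M]

/-- A set is generic if finitely many of its translates cover the group. -/
def Generic (D : Set M) : Prop :=
  ∃ F : Finset M, ∀ x, ∃ f ∈ F, x - f ∈ D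

theorem Generic.finiteIndex {H : AddSubgroup M} (h : Generic (H : Set M)) : H.FiniteIndex := by
  obtain ⟨F, hF⟩ := h
  have : Finite (M ⧸ H) := by
    refine Finite.of_surjective (fun f : F => (f : M ⧸ H)) fun q => ?_
    obtain ⟨x, rfl⟩ := QuotientAddGroup.mk_surjective q
    obtain ⟨f, hf, hx⟩ := hF x
    refine ⟨⟨f, hf⟩, QuotientAddGroup.eq.2 ?_⟩
    rwa [neg_add_eq_sub]
  exact AddSubgroup.finiteIndex_of_finite_quotient

theorem mk_quotient_le_of_generic (H : AddSubgroup M) {𝓕 : Set (Set M)} (hc : 𝓕.Countable)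
    (hg : ∀ E ∈ 𝓕, Generic E)
    (h : ∀ x y, (∀ E ∈ 𝓕, ∃ c, x - c ∈ E ∧ y - c ∈ E) → x - y ∈ H) :
    #(M ⧸ H) ≤ 2 ^ ℵ₀ := by
  have hg' : ∀ E : 𝓕, ∃ F : Finset M, ∀ x, ∃ f : F, x - (f : M) ∈ (E : Set M) := fun E => by
    obtain ⟨F, hF⟩ := hg E E.2
    exact ⟨F, fun x => let ⟨f, hf, hx⟩ := hF x; ⟨⟨f, hf⟩, hx⟩⟩
  choose F c hc' using hg'
  -- Code a coset by the translate of each `E` that contains its representative; equal codes force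
  -- equal cosets.
  have hinj : Function.Injective
      (fun (q : M ⧸ H) (E : 𝓕) => ((F E).equivFin (c E q.out) : ℕ)) := by
    intro p q hpq
    rw [← QuotientAddGroup.out_eq' q, ← QuotientAddGroup.out_eq' p, eq_comm, QuotientAddGroup.eq,
      neg_add_eq_sub]
    refine h _ _ fun E hE => ?_
    have h1 : c ⟨E, hE⟩ p.out = c ⟨E, hE⟩ q.out :=
      (F ⟨E, hE⟩).equivFin.injective (Fin.ext (congrFun hpq ⟨E, hE⟩))
    refine ⟨c ⟨E, hE⟩ q.out, ?_, hc' ⟨E, hE⟩ _⟩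
    rw [← h1]
    exact hc' ⟨E, hE⟩ _
  refine (mk_le_of_injective hinj).trans ?_
  rw [mk_arrow, mk_nat, lift_aleph0, lift_uzero]
  refine le_trans ?_ aleph0_power_aleph0.le
  exact power_le_power_left aleph0_ne_zero hc.le_aleph0

end Generic

/-! ### Connected components of the elementary extension. -/

section Extension

variable {α t : ℝ} {G : ElemExt.{u} α t} {κ : Cardinal.{u}}

instance (n : ℕ) : Countable (Func n) :=
  have : Subsingleton (Func n) := ⟨by rintro ⟨⟩ ⟨⟩; rfl⟩
  inferInstance

instance (n : ℕ) : Countable (Rel n) :=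
  have : Subsingleton (Rel n) := ⟨by rintro ⟨⟩ ⟨⟩; rfl⟩
  inferInstance

instance : Countable Lang.Symbols :=
  inferInstanceAs (Countable ((Σ n, Func n) ⊕ Σ n, Rel n))

theorem countable_definable (G : ElemExt.{u} α t) :
    {E : Set G | (∅ : Set G).Definable₁ Lang E}.Countable := by
  refine (Set.countable_range fun φ : Lang.Formula (Fin 1) =>
    {x : G | φ.Realize fun _ => x}).mono ?_
  intro E hE
  obtain ⟨φ, hφ⟩ := Set.empty_definable_iff.1 hE
  exact ⟨φ, Set.ext fun x => (Set.ext_iff.1 hφ fun _ => x).symm⟩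

theorem SameSet.generic {S : Set (ZX α t)} {S' : Set G} (hS : SameSet G S S') {K : ℕ}
    (c : Fin K → ZX α t) (h : ∀ x, ∃ i, x - c i ∈ S) : Generic S' := by
  classical
  refine ⟨Finset.univ.image fun i => G.emb (c i), fun x => ?_⟩
  obtain ⟨i, hi⟩ := hS.exists_sub_mem c h x
  exact ⟨_, Finset.mem_image_of_mem _ (Finset.mem_univ i), hi⟩

theorem generic_of_le (hG : IsSaturated Lang G κ) {H : AddSubgroup G} (hH : HasBoundedIndex κ H)
    {D : Set G} (hD : (∅ : Set G).Definable₁ Lang D) (hHD : (H : Set G) ⊆ D) : Generic D := by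
  by_contra hng
  obtain ⟨S, hS⟩ := SameSet.of_definable_ext hD
  let B : Set G := Set.range fun q : G ⧸ H => q.out
  have hB : #B < κ := mk_range_le.trans_lt hH
  -- If `D` is not generic, some `x` avoids `b + D` for all coset representatives `b`, although `x`
  -- lies in some `b + H`.
  have h := hG.sInter_nonempty hB (S := (fun b : G => {x | x - b ∉ D}) '' B) ?_ ?_
  · obtain ⟨x, hx⟩ := h
    refine hx _ ⟨_, ⟨(x : G ⧸ H), rfl⟩, rfl⟩ (hHD ?_)
    rw [← neg_add_eq_sub]
    exact QuotientAddGroup.eq.1 (QuotientAddGroup.out_eq' (x : G ⧸ H))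
  · rintro _ ⟨b, hb, rfl⟩
    have hy := SameTerm.var (G := G) (Sum.inr () : (Fin 1 ⊕ Unit) ⊕ Unit)
    have hc := SameTerm.var (G := G) (Sum.inl (Sum.inr ()) : (Fin 1 ⊕ Unit) ⊕ Unit)
    have hx := SameTerm.var (G := G) (Sum.inl (Sum.inl 0) : (Fin 1 ⊕ Unit) ⊕ Unit)
    have := ((hS.mem hy).and ((hy.add hc).eq hx)).ex.not.definable_fiber hb
    convert this using 1
    ext x
    refine not_congr ⟨fun h => ⟨x - b, h, sub_add_cancel x b⟩, ?_⟩
    rintro ⟨y, hy, hxy⟩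
    have hxy : y + b = x := hxy
    rw [← hxy, add_sub_cancel_right]
    exact hy
  · intro T hT hTf
    obtain ⟨F, -, hF, rfl⟩ := Set.exists_subset_image_finite_and.1 ⟨T, hT, hTf, rfl⟩
    by_contra hne
    refine hng ⟨hF.toFinset, fun x => ?_⟩
    by_contra! hx
    exact hne ⟨x, by rintro _ ⟨b, hb, rfl⟩; exact hx b (hF.mem_toFinset.2 hb)⟩

theorem exists_definable_sub_mem (hκ : ℵ₀ ≤ κ) (hG : IsSaturated Lang G κ) {H : AddSubgroup G}
    (hH : IsTypeDefinable Lang (∅ : Set G) (H : Set G))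
    {D : Set G} (hD : (∅ : Set G).Definable₁ Lang D) (hHD : (H : Set G) ⊆ D) :
    ∃ E : Set G, (∅ : Set G).Definable₁ Lang E ∧ (H : Set G) ⊆ E ∧
      ∀ x ∈ E, ∀ y ∈ E, x - y ∈ D := by
  by_contra! hne
  obtain ⟨S, hS⟩ := SameSet.of_definable_ext hD
  have hA : ∀ A : Set G, A.Finite → #A < κ := fun A hA =>
    (lt_aleph0_iff_set_finite.2 hA).trans_le hκ
  let 𝓔 : Set (Set G) := {E | (∅ : Set G).Definable₁ Lang E ∧ (H : Set G) ⊆ E}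
  have huniv : Set.univ ∈ 𝓔 := ⟨SameSet.univ.definable_ext, Set.subset_univ _⟩
  have hinter : ∀ E ∈ 𝓔, ∀ E' ∈ 𝓔, E ∩ E' ∈ 𝓔 := fun E hE E' hE' =>
    ⟨Set.Definable.inter hE.1 hE'.1, Set.subset_inter hE.2 hE'.2⟩
  -- Saturation concerns one variable, so a bad pair is realized in two stages: `x` first, then `y`
  -- over the parameter `x`. Both land in `H`, yet `x - y ∉ D`.
  have h := hG.exists_forall_mem (hA ∅ Set.finite_empty) huniv hinter
    (f := fun E => {x | x ∈ E ∧ ∃ y, y ∈ E ∧ x - y ∉ D})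
    (fun E E' h x ⟨h1, y, h2, h3⟩ => ⟨h h1, y, h h2, h3⟩) ?_ ?_
  · obtain ⟨x, hx⟩ := h
    have h := hG.exists_forall_mem (hA {x} (Set.finite_singleton x)) huniv hinter
      (f := fun E => {y | y ∈ E ∧ x - y ∉ D})
      (fun E E' h y ⟨h1, h2⟩ => ⟨h h1, h2⟩) ?_ ?_
    · obtain ⟨y, hy⟩ := h
      refine (hy _ huniv).2 (hHD (H.sub_mem ?_ ?_))
      · exact hH.mem_of_forall fun Y h1 h2 => (hx Y ⟨h1, h2⟩).1
      · exact hH.mem_of_forall fun Y h1 h2 => (hy Y ⟨h1, h2⟩).1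
    · rintro E ⟨hE, -⟩
      obtain ⟨T, hT⟩ := SameSet.of_definable_ext hE
      have hz := SameTerm.var (G := G) (Sum.inr () : (Fin 1 ⊕ Unit) ⊕ Unit)
      have hp := SameTerm.var (G := G) (Sum.inl (Sum.inr ()) : (Fin 1 ⊕ Unit) ⊕ Unit)
      have hv := SameTerm.var (G := G) (Sum.inl (Sum.inl 0) : (Fin 1 ⊕ Unit) ⊕ Unit)
      have hv' := SameTerm.var (G := G) (Sum.inl 0 : Fin 1 ⊕ Unit)
      have := ((hT.mem hv').and ((hS.mem hz).not.and ((hz.add hv).eq hp)).ex).definable_fiber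
        (Set.mem_singleton x)
      convert this using 1
      ext y
      refine and_congr Iff.rfl ⟨fun h => ⟨x - y, h, sub_add_cancel x y⟩, ?_⟩
      rintro ⟨z, hz, hxy⟩
      have hxy : z + y = x := hxy
      rw [← hxy, add_sub_cancel_right]
      exact hz
    · exact fun E hE => (hx E hE).2
  · rintro E ⟨hE, -⟩
    obtain ⟨T, hT⟩ := SameSet.of_definable_ext hE
    have hz := SameTerm.var (G := G) (Sum.inr () : (Fin 1 ⊕ Unit) ⊕ Unit)
    have hy := SameTerm.var (G := G) (Sum.inl (Sum.inr ()) : (Fin 1 ⊕ Unit) ⊕ Unit)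
    have hv := SameTerm.var (G := G) (Sum.inl (Sum.inl 0) : (Fin 1 ⊕ Unit) ⊕ Unit)
    have hy' := SameTerm.var (G := G) (Sum.inr () : Fin 1 ⊕ Unit)
    have hv' := SameTerm.var (G := G) (0 : Fin 1)
    have : SameSet G {x | x ∈ T ∧ ∃ y, y ∈ T ∧ ∃ z, z ∉ S ∧ z + y = x}
        {x | x ∈ E ∧ ∃ y, y ∈ E ∧ ∃ z, z ∉ D ∧ z + y = x} :=
      (hT.mem hv').and ((hT.mem hy').and ((hS.mem hz).not.and ((hz.add hy).eq hv)).ex).ex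
    convert this.definable_ext using 1
    ext x
    refine and_congr Iff.rfl (exists_congr fun y => and_congr Iff.rfl
      ⟨fun h => ⟨x - y, h, sub_add_cancel x y⟩, ?_⟩)
    rintro ⟨z, hz, hxy⟩
    rw [← hxy, add_sub_cancel_right]
    exact hz
  · rintro E ⟨h1, h2⟩
    obtain ⟨x, hx, y, hy, hxy⟩ := hne E h1 h2
    exact ⟨x, hx, y, hy, hxy⟩

theorem hasBoundedIndex_of_generic (hκ : 2 ^ ℵ₀ < κ) (H : AddSubgroup G)
    (h : ∀ x y, (∀ E : Set G, (∅ : Set G).Definable₁ Lang E → Generic E →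
      ∃ c, x - c ∈ E ∧ y - c ∈ E) → x - y ∈ H) : HasBoundedIndex κ H :=
  (mk_quotient_le_of_generic H (𝓕 := {E | (∅ : Set G).Definable₁ Lang E ∧ Generic E})
    ((countable_definable G).mono fun _ hE => hE.1) (fun _ hE => hE.2)
    fun x y hxy => h x y fun E h1 h2 => hxy E ⟨h1, h2⟩).trans_lt hκ

theorem exists_isTypeConnectedComponent (hκ : 2 ^ ℵ₀ < κ) (hG : IsSaturated Lang G κ) :
    ∃ H : AddSubgroup G, IsTypeConnectedComponent Lang κ (∅ : Set G) H := by
  let H₀ : AddSubgroup G :=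
    sInf {H | IsTypeDefinable Lang (∅ : Set G) (H : Set G) ∧ HasBoundedIndex κ H}
  -- All `∅`-definable supersets of `H₀` cut it out, since they include those of each `H` in the
  -- infimum.
  refine ⟨H₀, ⟨⟨{Y | (∅ : Set G).Definable₁ Lang Y ∧ (H₀ : Set G) ⊆ Y},
    fun Y hY => hY.1, ?_⟩, ?_⟩, fun H hH => sInf_le hH⟩
  · refine Set.Subset.antisymm (fun x hx Y hY => hY.2 hx) (fun x hx => ?_)
    exact AddSubgroup.mem_sInf.2 fun H hH => hH.1.mem_of_forall fun Y h1 h2 =>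
      hx Y ⟨h1, (SetLike.coe_subset_coe.2 (sInf_le hH)).trans h2⟩
  · refine hasBoundedIndex_of_generic hκ _ fun x y hxy => ?_
    refine AddSubgroup.mem_sInf.2 fun H hH => hH.1.mem_of_forall fun Y h1 h2 => ?_
    obtain ⟨E, hE, hHE, hEY⟩ := exists_definable_sub_mem
      ((cantor ℵ₀).le.trans hκ.le) hG hH.1 h1 h2
    obtain ⟨c, hx, hy⟩ := hxy E hE (generic_of_le hG hH.2 hE hHE)
    have := hEY _ hx _ hy
    rwa [sub_sub_sub_cancel_right] at this

theorem generic_range_nsmul (G : ElemExt.{u} α t) (n : ℕ) (hn : 1 ≤ n) :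
    Generic (Set.range fun y : G => n • y) := by
  refine (SameSet.range_nsmul G n hn).generic (K := n) (fun i => ((i : ℕ) : ℤ)) fun (x : ℤ) => ?_
  have hn' : (0 : ℤ) < n := by exact_mod_cast hn
  have h0 := Int.emod_nonneg x hn'.ne'
  have h1 := Int.emod_lt_of_pos x hn'
  refine ⟨⟨(x % n).toNat, by omega⟩, (x / n : ℤ), ?_⟩
  change (n : ℕ) • (x / n : ℤ) = x - ((x % n).toNat : ℤ)
  rw [Int.toNat_of_nonneg h0, nsmul_eq_mul]
  have := Int.emod_add_mul_ediv x n
  linarith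

theorem coe_connectedComponent (G : ElemExt.{u} α t) (A : Set G) :
    (connectedComponent Lang A : Set G) =
      ⋂ (n : ℕ) (_ : 1 ≤ n), Set.range (fun y : G => n • y) := by
  ext x
  simp only [connectedComponent, Set.mem_iInter, SetLike.mem_coe, AddSubgroup.mem_sInf]
  constructor
  · intro h n hn
    refine h (nsmulAddMonoidHom (α := G) n).range ⟨?_, Generic.finiteIndex ?_⟩
    · exact Set.Definable.mono (SameSet.range_nsmul G n hn).definable_ext (Set.empty_subset A)
    · exact generic_range_nsmul G n hn
  · rintro h H ⟨-, hH⟩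
    obtain ⟨y, rfl⟩ := h H.index (Nat.one_le_iff_ne_zero.2 hH.index_ne_zero)
    exact H.nsmul_index_mem y

theorem generic_XStar (hα : Irrational α) (ht0 : 0 < t) (ht : t < 1 / 2)
    (G : ElemExt.{u} α t) (n : ℕ) (hn : 1 ≤ n) : Generic (G.XStar (t / n)) := by
  have hn0 : (0 : ℝ) < n := by exact_mod_cast hn
  obtain ⟨K, c, hc⟩ := exists_rot_cover hα (div_pos ht0 hn0)
  exact (sameSet_XStar G hα ht0 ht n hn).generic c hc

theorem sub_mem_XStar (hα : Irrational α) (ht0 : 0 < t) (ht : t < 1 / 2)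
    {n : ℕ} (hn : 1 ≤ n) {x y : G} (hx : x ∈ G.XStar (t / (2 * n : ℕ)))
    (hy : y ∈ G.XStar (t / (2 * n : ℕ))) : x - y ∈ G.XStar (t / n) := by
  refine (sameSet_XStar G hα ht0 ht (2 * n) (by omega)).sub_mem
    (sameSet_XStar G hα ht0 ht n hn) (fun (x : ℤ) hx (y : ℤ) hy => ?_) x hx y hy
  refine mem_X_iff.2 ?_
  have hx := mem_X_iff.1 hx
  have hy := mem_X_iff.1 hy
  have h : t / n = t / (2 * n : ℕ) + t / (2 * n : ℕ) := by
    push_cast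
    field_simp
    norm_num
  rw [h]
  exact ((congrArg norm (rot_sub x y)).trans_le (norm_sub_le _ _)).trans_lt (add_lt_add hx hy)

/-- The intersection of `⋂ nℤ*` with all the sets `X_α(t/n)`. -/
theorem exists_addSubgroup_iInter_XStar (hα : Irrational α) (ht0 : 0 < t) (ht : t < 1 / 2)
    (G : ElemExt.{u} α t) : ∃ H : AddSubgroup G,
    (H : Set G) = (connectedComponent Lang (∅ : Set G) : Set G) ∩
      ⋂ (n : ℕ) (_ : 1 ≤ n), G.XStar (t / n) := by
  refine ⟨AddSubgroup.ofSub ((connectedComponent Lang (∅ : Set G) : Set G) ∩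
    ⋂ (n : ℕ) (_ : 1 ≤ n), G.XStar (t / n)) ⟨0, zero_mem _, ?_⟩ ?_, rfl⟩
  · refine Set.mem_iInter₂.2 fun n hn => (sameSet_XStar G hα ht0 ht n hn).zero_mem ?_
    refine mem_X_iff.2 ?_
    have hn0 : (0 : ℝ) < n := by exact_mod_cast hn
    have : ‖rot α 0‖ < t / n := by
      rw [rot_eq_zsmul, zero_zsmul, norm_zero]
      positivity
    exact this
  · rintro x ⟨hx, hx'⟩ y ⟨hy, hy'⟩
    rw [← sub_eq_add_neg]
    refine ⟨sub_mem hx hy, Set.mem_iInter₂.2 fun n hn => ?_⟩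
    exact sub_mem_XStar hα ht0 ht hn (Set.mem_iInter₂.1 hx' (2 * n) (by omega))
      (Set.mem_iInter₂.1 hy' (2 * n) (by omega))

theorem exists_mem_iInter_range_nsmul_notMem_XStar (hα : Irrational α) (ht0 : 0 < t) (ht : t < 1 / 2)
    (hκ : 0 < κ) (hG : IsSaturated Lang G κ) :
    ∃ x : G, (∀ n : ℕ, 1 ≤ n → x ∈ Set.range fun y : G => n • y) ∧ x ∉ G.XStar (t / (1 : ℕ)) := by
  have hX := sameSet_XStar G hα ht0 ht 1 le_rfl
  have h := hG.exists_forall_mem (A := ∅) (by simpa using hκ)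
    (𝓔 := {E | (∅ : Set G).Definable₁ Lang E ∧
      ∃ n : ℕ, 1 ≤ n ∧ (Set.range fun y : G => n • y) ⊆ E})
    ⟨SameSet.univ.definable_ext, 1, le_rfl, Set.subset_univ _⟩ ?_
    (f := fun E => E ∩ (G.XStar (t / (1 : ℕ)))ᶜ) (fun E E' h => Set.inter_subset_inter_left _ h)
    (fun E hE => Set.Definable.inter hE.1 (Set.Definable.compl hX.definable_ext)) ?_
  · obtain ⟨x, hx⟩ := h
    exact ⟨x, fun n hn => (hx _ ⟨(SameSet.range_nsmul G n hn).definable_ext, n, hn,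
      subset_rfl⟩).1, (hx _ ⟨SameSet.univ.definable_ext, 1, le_rfl, Set.subset_univ _⟩).2⟩
  · rintro E ⟨hE, n, hn, hnE⟩ E' ⟨hE', m, hm, hmE⟩
    refine ⟨Set.Definable.inter hE hE', n * m, Nat.mul_pos hn hm, ?_⟩
    rintro _ ⟨y, rfl⟩
    refine ⟨hnE ⟨m • y, ?_⟩, hmE ⟨n • y, ?_⟩⟩
    · beta_reduce
      rw [mul_comm, mul_nsmul]
    · beta_reduce
      rw [mul_nsmul]
  · rintro E ⟨-, n, hn, hnE⟩
    -- Rotating by `nα` traces the multiples of `n`, so one of them comes within `1/2 - t` of the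
    -- point `1/2` and misses `X_α(t)`.
    have hα' : Irrational (n * α) := hα.natCast_mul (by omega)
    obtain ⟨k, hk⟩ := exists_norm_rot_sub_lt hα' ((1 / 2 : ℝ) : UnitAddCircle)
      (ε := 1 / 2 - t) (by linarith)
    have hrot : rot (n * α) k = rot α (n • k) := by
      rw [rot, rot]
      push_cast [nsmul_eq_mul]
      rw [mul_left_comm, mul_assoc]
    refine ⟨G.emb (n • k : ℤ), hnE ?_, fun h => ?_⟩
    · exact ((SameSet.range_nsmul G n hn).iff_emb fun _ => (n • k : ℤ)).1 ⟨k, rfl⟩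
    · have h' : (n • k : ℤ) ∈ X α (t / (1 : ℕ)) := (hX.iff_emb fun _ => (n • k : ℤ)).2 h
      rw [mem_X_iff, Nat.cast_one, div_one, ← hrot] at h'
      have := norm_sub_le (rot (n * α) k) (rot (n * α) k - ((1 / 2 : ℝ) : UnitAddCircle))
      rw [sub_sub_cancel, norm_half] at this
      linarith

end Extension

end IntExpansion

theorem corollary4p4 (α t : ℝ) (hα : Irrational α) (ht0 : 0 < t) (ht : t < 1 / 2)
    (κ : Cardinal.{u}) (G : IntExpansion.ElemExt.{u} α t) (hG : G.IsSufficientlySaturated κ) :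
    -- every set `X_α(t/n)` is `∅`-definable in `(ℤ, +, X_α(t))`
    (∀ n : ℕ, 1 ≤ n → (∅ : Set (IntExpansion.ZX α t)).Definable₁ IntExpansion.Lang
      (IntExpansion.X α (t / n) : Set ℤ)) ∧
    -- the connected component does not depend on the small set of parameters
    (∀ A : Set G, Cardinal.mk A < κ →
      IntExpansion.connectedComponent IntExpansion.Lang A =
        IntExpansion.connectedComponent IntExpansion.Lang (∅ : Set G)) ∧
    -- and it is the intersection of the groups `nℤ*`
    (IntExpansion.connectedComponent IntExpansion.Lang (∅ : Set G) : Set G) =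
      ⋂ (n : ℕ) (_ : 1 ≤ n), Set.range (fun y : G => n • y) ∧
    ∃ Gt : AddSubgroup G,
      (Gt : Set G) = (IntExpansion.connectedComponent IntExpansion.Lang (∅ : Set G) : Set G) ∩
        ⋂ (n : ℕ) (_ : 1 ≤ n), G.XStar (t / n) ∧
      IntExpansion.IsTypeDefinable IntExpansion.Lang (∅ : Set G) (Gt : Set G) ∧
      IntExpansion.HasBoundedIndex κ Gt ∧
      Gt < IntExpansion.connectedComponent IntExpansion.Lang (∅ : Set G) ∧
      ∃ G00 : AddSubgroup G,
        IntExpansion.IsTypeConnectedComponent IntExpansion.Lang κ (∅ : Set G) G00 ∧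
        G00 ≤ Gt := by
  open IntExpansion in
  refine ⟨fun n hn => (sameSet_XStar G hα ht0 ht n hn).definable,
    fun A _ => SetLike.coe_injective ?_, coe_connectedComponent G ∅, ?_⟩
  · rw [coe_connectedComponent, coe_connectedComponent]
  obtain ⟨Gt, hGt⟩ := exists_addSubgroup_iInter_XStar hα ht0 ht G
  have hmem : ∀ x, x ∈ Gt ↔ (∀ n : ℕ, 1 ≤ n → x ∈ Set.range fun y : G => n • y) ∧
      ∀ n : ℕ, 1 ≤ n → x ∈ G.XStar (t / n) := fun x => by
    rw [← SetLike.mem_coe, hGt, coe_connectedComponent]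
    simp only [Set.mem_inter_iff, Set.mem_iInter]
  have htd : IsTypeDefinable Lang (∅ : Set G) (Gt : Set G) := by
    refine ⟨{Y | ∃ n : ℕ, 1 ≤ n ∧ ((Y = Set.range fun y : G => n • y) ∨ Y = G.XStar (t / n))},
      ?_, ?_⟩
    · rintro Y ⟨n, hn, rfl | rfl⟩
      · exact (SameSet.range_nsmul G n hn).definable_ext
      · exact (sameSet_XStar G hα ht0 ht n hn).definable_ext
    · ext x
      rw [SetLike.mem_coe, hmem]
      constructor
      · rintro ⟨h1, h2⟩ Y ⟨n, hn, rfl | rfl⟩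
        exacts [h1 n hn, h2 n hn]
      · exact fun h => ⟨fun n hn => h _ ⟨n, hn, .inl rfl⟩, fun n hn => h _ ⟨n, hn, .inr rfl⟩⟩
  have hbd : HasBoundedIndex κ Gt := by
    refine hasBoundedIndex_of_generic hG.big Gt fun x y hxy => (hmem _).2 ⟨fun n hn => ?_,
      fun n hn => ?_⟩
    · obtain ⟨c, ⟨a, ha⟩, b, hb⟩ := hxy _ (SameSet.range_nsmul G n hn).definable_ext
        (generic_range_nsmul G n hn)
      refine ⟨a - b, ?_⟩
      beta_reduce at ha hb ⊢
      rw [nsmul_sub, ha, hb, sub_sub_sub_cancel_right]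
    · have hn2 : 1 ≤ 2 * n := by omega
      obtain ⟨c, hx, hy⟩ := hxy _ (sameSet_XStar G hα ht0 ht _ hn2).definable_ext
        (generic_XStar hα ht0 ht G _ hn2)
      rw [← sub_sub_sub_cancel_right x y c]
      exact sub_mem_XStar hα ht0 ht hn hx hy
  obtain ⟨G00, hG00⟩ := exists_isTypeConnectedComponent hG.big hG.saturated
  refine ⟨Gt, hGt, htd, hbd, ?_, G00, hG00, hG00.2 ⟨htd, hbd⟩⟩
  obtain ⟨x, hx, hx'⟩ := exists_mem_iInter_range_nsmul_notMem_XStar hα ht0 ht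
    (zero_le.trans_lt hG.big) hG.saturated
  refine lt_of_le_of_ne (SetLike.coe_subset_coe.1 (hGt ▸ Set.inter_subset_left)) fun h => ?_
  refine hx' (((hmem x).1 ?_).2 1 le_rfl)
  rw [h, ← SetLike.mem_coe, coe_connectedComponent]
  exact Set.mem_iInter₂.2 hx
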